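/- Let $J=[-1,1]$ and, for $s\in J$, let $J_s=J\times\{s\}$; let $\mathcal A$ (resp. $\mathcal A'$) be the family of all nonempty connected closed subsets of $J_1$ (resp. of $J_{-1}$). Define $f_{01}:J\to J$ by $f_{01}(s)=(s+1)/2$ for $0\le s\le 1$, $f_{01}(s)=s+1/2$ for $-1/2\le s\le 0$, and $f_{01}(s)=2s+1$ for $-1\le s\le -1/2$, and put $f_{02}(r,s)=(r,f_{01}(s))$ on $J^2$. A homeomorphism $f:J^2\to J^2$ is called *normally rising* if $f=f_{02}$ on the boundary $\partial J^2$ of the square and $f(J_s)=f_{02}(J_s)$ for every $s\in J$. A map $\phi$ from $J$ to $\mathcal A$ (or to $\mathcal A'$) is called *increasing* if, for all $r_1<r_2$ in $J$, the minimal abscissa of $\phi(r_1)$ is at most the minimal abscissa of $\phi(r_2)$, and the maximal abscissa of $\phi(r_1)$ is at most the maximal abscissa of $\phi(r_2)$. A map $\phi:J\to\mathcal A$ (resp. $\phi:J\to\mathcal A'$) is called *endpoint preserving* if $\phi(-1)=\{(-1,1)\}$ and $\phi(1)=\{(1,1)\}$ (resp. $\phi(-1)=\{(-1,-1)\}$ and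 $\phi(1)=\{(1,-1)\}$). For a homeomorphism $f$ of $J^2$, $\omega_f(x)$ is the set of all $y$ for which there are positive integers $n_1<n_2<\cdots$ with $f^{n_i}(x)\to y$, and $\alpha_f(x)=\omega_{f^{-1}}(x)$. **Theorem.** Let $\mathbb N',\mathbb N''\subseteq\mathbb N$ be nonempty, and let $(V_n)_{n\in\mathbb N'}$ and $(W_j)_{j\in\mathbb N''}$ be two families of nonempty connected subsets of $(0,1/2]$ such that $V_m\cap V_n=\emptyset$ for $m\ne n$ in $\mathbb N'$ and $W_i\cap W_j=\emptyset$ for $i\neq j$ in $\mathbb N''$. For each $n\in\mathbb N'$ and each $j\in\mathbb N''$ let $\omega_n:J\to\mathcal A$ and $\alpha_j:J\to\mathcal A'$ be arbitrary increasing and endpoint preserving maps. Then there exists a normally rising homeomorphism $f:J^2\to J^2$ such that $$\omega_f(r,s)=\omega_n(r)\quad\text{for all } n\in\mathbb N',\ s\in V_n,\ r\in J,$$ $$\alpha_f(r,t)=\alpha_j(r)\quad\text{for all } j\in\mathbb N'',\ t\in W_j,\ r\in J.$$ -/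

import Mathlib

namespace LimitSets

open Filter Topology

/-- `ω_f(x)`: the set of all `y` such that `f^{n_i}(x) → y` for some sequence of positive
integers `n_0 < n_1 < n_2 < ⋯`. -/
def omegaLim {X : Type*} [MetricSpace X] (f : X → X) (x : X) : Set X :=
  {y | ∃ n : ℕ → ℕ, StrictMono n ∧ (∀ i, 0 < n i) ∧
    Tendsto (fun i => f^[n i] x) atTop (𝓝 y)}

/-- `α_f(x) = ω_{f⁻¹}(x)` for a homeomorphism `f`. -/
def alphaLim {X : Type*} [MetricSpace X] (f : X ≃ₜ X) (x : X) : Set X :=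
  omegaLim f.symm x

/-- `J = [-1, 1]`; the square `J²` is the product `J × J`. -/
abbrev J : Type := Set.Icc (-1 : ℝ) 1

/-- The left endpoint `-1` of `J`. -/
def jMin : J := ⟨-1, by norm_num⟩

/-- The right endpoint `1` of `J`. -/
def jMax : J := ⟨1, by norm_num⟩

/-- The horizontal segment `J_s = J × {s}`. -/
def level (s : J) : Set (J × J) := {x | x.2 = s}

/-- The boundary of the square (as a manifold, that is, its frontier in the plane). -/
def squareBoundary : Set (J × J) :=
  {x | x.1 = jMin ∨ x.1 = jMax ∨ x.2 = jMin ∨ x.2 = jMax}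

/-- The piecewise linear homeomorphism `f₀₁` of `J`. -/
noncomputable def f01 (s : J) : J :=
  ⟨if 0 ≤ (s : ℝ) then ((s : ℝ) + 1) / 2
    else if -(1 / 2) ≤ (s : ℝ) then (s : ℝ) + 1 / 2
    else 2 * (s : ℝ) + 1, by
    obtain ⟨s, h₁, h₂⟩ := s
    dsimp only
    split_ifs with h h' <;> constructor <;> linarith⟩

/-- `f₀₂(r, s) = (r, f₀₁(s))`. -/
noncomputable def f02 (x : J × J) : J × J := (x.1, f01 x.2)

/-- A homeomorphism `f` of `J²` is normally rising if it agrees with `f₀₂` on the boundary of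
the square and `f(J_s) = f₀₂(J_s)` for every `s ∈ J`. -/
def NormallyRising (f : (J × J) ≃ₜ (J × J)) : Prop :=
  (∀ x ∈ squareBoundary, f x = f02 x) ∧ ∀ s : J, f '' level s = f02 '' level s

/-- The family `𝒞_s` of all nonempty connected closed subsets of `J_s`
(`IsConnected` includes nonemptiness). -/
def Continua (s : J) : Set (Set (J × J)) :=
  {A | A ⊆ level s ∧ IsConnected A ∧ IsClosed A}

/-- The family `𝒜` of nonempty connected closed subsets of the top edge `J_1`. -/
abbrev TopContinua : Set (Set (J × J)) := Continua jMax

/-- The family `𝒜'` of nonempty connected closed subsets of the bottom edge `J_{-1}`. -/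
abbrev BottomContinua : Set (Set (J × J)) := Continua jMin

/-- The set of abscissae of the points of `A`. -/
def abscissae (A : Set (J × J)) : Set ℝ := (fun x : J × J => (x.1 : ℝ)) '' A

/-- For `A ∈ 𝒞_s` the infimum of the abscissae is a minimum. -/
theorem isLeast_abscissae {s : J} {A : Set (J × J)} (hA : A ∈ Continua s) :
    IsLeast (abscissae A) (sInf (abscissae A)) :=
  (hA.2.2.isCompact.image (by fun_prop)).isLeast_sInf (hA.2.1.nonempty.image _)

/-- For `A ∈ 𝒞_s` the supremum of the abscissae is a maximum. -/
theorem isGreatest_abscissae {s : J} {A : Set (J × J)} (hA : A ∈ Continua s) :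
    IsGreatest (abscissae A) (sSup (abscissae A)) :=
  (hA.2.2.isCompact.image (by fun_prop)).isGreatest_sSup (hA.2.1.nonempty.image _)

/-- A map `φ : J → 𝒞_s` is increasing if the minimum and the maximum of the abscissae of
`φ(r)` are (weakly) increasing functions of `r`. -/
def Increasing {s : J} (φ : J → Continua s) : Prop :=
  ∀ r₁ r₂ : J, r₁ < r₂ →
    sInf (abscissae (φ r₁)) ≤ sInf (abscissae (φ r₂)) ∧
    sSup (abscissae (φ r₁)) ≤ sSup (abscissae (φ r₂))

/-- A map `φ : J → 𝒞_s` is endpoint preserving if `φ(-1) = {(-1, s)}` and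
`φ(1) = {(1, s)}`. -/
def EndpointPreserving {s : J} (φ : J → Continua s) : Prop :=
  (φ jMin : Set (J × J)) = {(jMin, s)} ∧ (φ jMax : Set (J × J)) = {(jMax, s)}

/-- `ω_{sf}(r) = ω_f(r, s)`. -/
def omegaSlice (f : (J × J) ≃ₜ (J × J)) (s : J) (r : J) : Set (J × J) :=
  omegaLim f (r, s)

/-- `α_{sf}(r) = α_f(r, s)`. -/
def alphaSlice (f : (J × J) ≃ₜ (J × J)) (s : J) (r : J) : Set (J × J) :=
  alphaLim f (r, s)

end LimitSets

open LimitSets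

/-!
A rising homeomorphism has the form `f (r, s) = (g_s r, f₀₁ s)`, and the points of the level
`s ∈ (0, 1 / 2]` converge to the top edge, so `ω_f (r, s)` is the set of cluster points of the
horizontal coordinates of the orbit.

Suppose first that only `ω`-limit sets are prescribed. In the time coordinate
`levelTime s = -log₂ (1 - s)`, the map `f₀₁` is the translation by `1` above the level `0`. Choose a
family `G t` of increasing homeomorphisms of `[-1, 1]`, jointly continuous, with `G t = id` for
`t ≤ 1` and with `G (t + 1) - G t → 0` uniformly, and let `f` carry `(G t r, s)` to
`(G (t + 1) r, f₀₁ s)`, where `t = levelTime s`. The last property of `G` makes `f` continuous at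
the top edge (`exists_homeo_of_horizontal_family`), and the orbit of `(r, s)` has the horizontal
coordinates `G (levelTime s + k) r`. A sequence with steps tending to `0` clusters exactly at the
points between its lower and its upper limit (`mapClusterPt_of_step_tendsto_zero`), so these limits
have to be the endpoints `a n r` and `b n r` of the `n`-th prescribed continuum when `s ∈ V n`.

The functions `a n` and `b n` are monotone but may jump. Still, every monotone function is a
pointwise limit, at its jumps too, of continuous monotone functions
(`exists_continuous_monotone_tendsto`), which a small perturbation makes strictly monotone. The
family `G` passes ever more slowly through a sequence of stages, which on the levels of `V n`
approximate `a n` and `b n` in turn (`exists_stages`, `exists_horizontal_family`). Only finitely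
many indices take part in each stage. They are mixed with weights that depend continuously on the level,
are constant along orbits, and converge pointwise to the indicator function of `V n`
(`exists_periodic_weight`); since the `V n` are disjoint, giving priority to the smaller indices
(`priorityMix`) isolates the index `n` in the limit on `V n`.

For the `α`-limit sets, `f₀₁⁻¹` is conjugate to `f₀₁` by `s ↦ -s`, so the same construction gives a
homeomorphism with prescribed `α`-limit sets that differs from `f₀₂` only below the level `-1 / 2`.
The two are combined by `exists_normallyRising_of_halves`.
-/

namespace LimitSets

open Filter Topology

/-! ### Limit sets and cluster points -/

theorem mem_omegaLim_iff {X : Type*} [MetricSpace X] {f : X → X} {x y : X} :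
    y ∈ omegaLim f x ↔ MapClusterPt y atTop (fun k : ℕ => f^[k] x) := by
  constructor
  · rintro ⟨n, hn, -, h⟩
    exact h.mapClusterPt.of_comp hn.tendsto_atTop
  · intro h
    obtain ⟨n, hn, hlim⟩ := h.tendsto_subseq
    refine ⟨fun i => n (i + 1), fun i j hij => hn (by omega), fun i => ?_,
      hlim.comp (tendsto_add_atTop_nat 1)⟩
    exact (Nat.zero_le _).trans_lt (hn (Nat.lt_succ_self i))

theorem omegaLim_apply {X : Type*} [MetricSpace X] (f : X → X) (x : X) :
    omegaLim f (f x) = omegaLim f x := by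
  ext y
  rw [mem_omegaLim_iff, mem_omegaLim_iff, MapClusterPt, MapClusterPt]
  have h : (fun k : ℕ => f^[k] (f x)) = (fun k : ℕ => f^[k] x) ∘ (fun k => k + 1) := by
    funext k
    simp [Function.iterate_succ_apply]
  rw [h, ← Filter.map_map, Filter.map_add_atTop_eq_nat]

/-- The limit set only depends on the map along the orbit. -/
theorem omegaLim_congr {X : Type*} [MetricSpace X] {f g : X → X} {S : Set X}
    (hfg : Set.EqOn f g S) (hg : Set.MapsTo g S S) {x : X} (hx : x ∈ S) :
    omegaLim f x = omegaLim g x := by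
  have key : ∀ k : ℕ, f^[k] x = g^[k] x := by
    intro k
    induction k with
    | zero => rfl
    | succ k ih =>
      rw [Function.iterate_succ_apply', Function.iterate_succ_apply', ih]
      exact hfg (hg.iterate k hx)
  ext y
  simp only [mem_omegaLim_iff, key]

/-- Conjugating a map by a homeomorphism transports its limit sets. -/
theorem omegaLim_conj {X : Type*} [MetricSpace X] (ρ : X ≃ₜ X) (f : X → X) (x : X) :
    omegaLim (ρ ∘ f ∘ ρ.symm) x = ρ '' omegaLim f (ρ.symm x) := by
  have hs : Function.Semiconj ρ f (ρ ∘ f ∘ ρ.symm) := fun z => by simp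
  have key : ∀ k : ℕ, (ρ ∘ f ∘ ρ.symm)^[k] x = ρ (f^[k] (ρ.symm x)) := fun k => by
    simpa using ((hs.iterate_right k) (ρ.symm x)).symm
  ext y
  rw [ρ.image_eq_preimage_symm, Set.mem_preimage]
  simp only [omegaLim, Set.mem_ofPred_eq, key]
  constructor
  · rintro ⟨n, h1, h2, h3⟩
    refine ⟨n, h1, h2, ?_⟩
    simpa [Function.comp_def] using (ρ.symm.continuous.tendsto y).comp h3
  · rintro ⟨n, h1, h2, h3⟩
    refine ⟨n, h1, h2, ?_⟩
    simpa [Function.comp_def] using (ρ.continuous.tendsto _).comp h3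

/-- A real sequence with steps tending to `0` clusters at every value between its lower and its
upper limit: otherwise it would eventually have to jump over a gap of fixed width. -/
theorem mapClusterPt_of_step_tendsto_zero {u : ℕ → ℝ} {y : ℝ}
    (hstep : Tendsto (fun k => u (k + 1) - u k) atTop (𝓝 0))
    (hlo : ∀ ε > 0, ∃ᶠ k in atTop, u k < y + ε) (hhi : ∀ ε > 0, ∃ᶠ k in atTop, y - ε < u k) :
    MapClusterPt y atTop u := by
  rw [mapClusterPt_iff_frequently]
  intro s hs
  obtain ⟨ε, hε, hball⟩ := Metric.mem_nhds_iff.1 hs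
  suffices h : ∃ᶠ k in atTop, u k ∈ Metric.ball y ε from h.mono fun k hk => hball hk
  intro hcon
  rw [Metric.tendsto_atTop] at hstep
  obtain ⟨N₁, hN₁⟩ := hstep ε hε
  obtain ⟨N₂, hN₂⟩ := eventually_atTop.1 hcon
  simp only [Metric.mem_ball, Real.dist_eq, not_lt, sub_zero] at hN₁ hN₂
  set N := max N₁ N₂
  rcases le_abs'.1 (hN₂ N (le_max_right _ _)) with h | h
  · have hstay : ∀ k ≥ N, u k ≤ y - ε := by
      intro k hk
      induction k, hk using Nat.le_induction with
      | base => linarith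
      | succ k hk ih =>
        have h1 := (abs_lt.1 (hN₁ k ((le_max_left _ _).trans hk))).2
        rcases le_abs'.1 (hN₂ (k + 1) ((le_max_right _ _).trans (hk.trans k.le_succ))) with h2 | h2
          <;> linarith
    obtain ⟨k, hk, hk'⟩ := frequently_atTop.1 (hhi ε hε) N
    linarith [hstay k hk]
  · have hstay : ∀ k ≥ N, y + ε ≤ u k := by
      intro k hk
      induction k, hk using Nat.le_induction with
      | base => linarith
      | succ k hk ih =>
        have h1 := (abs_lt.1 (hN₁ k ((le_max_left _ _).trans hk))).1
        rcases le_abs'.1 (hN₂ (k + 1) ((le_max_right _ _).trans (hk.trans k.le_succ))) with h2 | h2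
          <;> linarith
    obtain ⟨k, hk, hk'⟩ := frequently_atTop.1 (hlo ε hε) N
    linarith [hstay k hk]

/-! ### Monotone functions as limits of continuous monotone functions -/

/-- The interpolant is `x ↦ min_{y ∈ S} (a y + K * max 0 (x - y))`, with `K` at least all slopes
of `a` between points of `S`. -/
theorem exists_continuous_monotone_eqOn {a : ℝ → ℝ} (ha : Monotone a) {S : Finset ℝ}
    (hS : S.Nonempty) :
    ∃ p : ℝ → ℝ, Continuous p ∧ Monotone p ∧ ∀ x ∈ S, p x = a x := by
  obtain ⟨K, hK⟩ := ((S ×ˢ S).image fun z => (a z.1 - a z.2) / (z.1 - z.2)).bddAbove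
  have hK' : ∀ x ∈ S, ∀ y ∈ S, (a x - a y) / (x - y) ≤ max K 0 := fun x hx y hy =>
    (hK (Finset.mem_coe.2 (Finset.mem_image.2 ⟨(x, y), by simp [hx, hy], rfl⟩))).trans
      (le_max_left _ _)
  have hK0 : 0 ≤ max K 0 := le_max_right _ _
  generalize max K 0 = L at hK' hK0
  refine ⟨fun x => S.inf' hS fun y => a y + L * max 0 (x - y), ?_, ?_, ?_⟩
  · exact Continuous.finset_inf'_apply hS fun y _ => by fun_prop
  · intro x x' hx
    refine Finset.le_inf' hS _ fun y hy => (Finset.inf'_le _ hy).trans ?_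
    gcongr
  · intro x hx
    refine le_antisymm ((Finset.inf'_le _ hx).trans (by simp)) (Finset.le_inf' hS _ fun y hy => ?_)
    rcases le_or_gt x y with h | h
    · have : 0 ≤ L * max 0 (x - y) := mul_nonneg hK0 (le_max_left _ _)
      linarith [ha h]
    · have h1 := hK' x hx y hy
      rw [div_le_iff₀ (by linarith)] at h1
      rw [max_eq_right (by linarith)]
      linarith

/-- Interpolating on finite sets that exhaust the rationals and the (countably many)
discontinuities gives convergence at every point, jump points included. -/
theorem exists_continuous_monotone_tendsto {a : ℝ → ℝ} (ha : Monotone a) :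
    ∃ p : ℕ → ℝ → ℝ, (∀ m, Continuous (p m)) ∧ (∀ m, Monotone (p m)) ∧
      (∀ m, p m (-1) = a (-1)) ∧ (∀ m, p m 1 = a 1) ∧
      ∀ x, Tendsto (fun m => p m x) atTop (𝓝 (a x)) := by
  obtain ⟨e, he⟩ := (ha.countable_not_continuousAt.union
    (Set.countable_range ((↑) : ℚ → ℝ))).exists_eq_range ⟨_, Or.inr ⟨0, rfl⟩⟩
  have hS : ∀ m, (insert (-1) (insert 1 ((Finset.range m).image e)) : Finset ℝ).Nonempty :=
    fun m => Finset.insert_nonempty _ _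
  choose p hpc hpm hpe using fun m => exists_continuous_monotone_eqOn ha (hS m)
  have hev : ∀ x ∈ Set.range e, ∀ᶠ m in atTop, p m x = a x := by
    rintro _ ⟨i, rfl⟩
    filter_upwards [eventually_gt_atTop i] with m hm
    exact hpe m _ (by simp only [Finset.mem_insert, Finset.mem_image, Finset.mem_range]; grind)
  refine ⟨p, hpc, hpm, fun m => hpe m _ (by simp), fun m => hpe m _ (by simp), fun x => ?_⟩
  by_cases hx : ContinuousAt a x
  · rw [tendsto_order]
    constructor
    · intro c hc
      obtain ⟨l, hl, hlc⟩ := exists_Ioc_subset_of_mem_nhds (hx.eventually (lt_mem_nhds hc))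
        ⟨x - 1, by linarith⟩
      obtain ⟨q, hq1, hq2⟩ := exists_rat_btwn hl
      filter_upwards [hev q (he ▸ Or.inr ⟨q, rfl⟩)] with m hm
      exact (hlc ⟨hq1, hq2.le⟩ : c < a q).trans_le (hm ▸ hpm m hq2.le)
    · intro c hc
      obtain ⟨l, hl, hlc⟩ := exists_Ico_subset_of_mem_nhds (hx.eventually (gt_mem_nhds hc))
        ⟨x + 1, by linarith⟩
      obtain ⟨q, hq1, hq2⟩ := exists_rat_btwn hl
      filter_upwards [hev q (he ▸ Or.inr ⟨q, rfl⟩)] with m hm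
      exact (hm ▸ hpm m hq1.le : p m x ≤ a q).trans_lt (hlc ⟨hq1.le, hq2⟩ : a q < c)
  · exact tendsto_const_nhds.congr' ((hev x (he ▸ Or.inl hx)).mono fun m hm => hm.symm)

/-- The indicator function of an interval is a product of a monotone and an antitone function. -/
theorem exists_continuous_tendsto_indicator {V : Set ℝ} (hV : V.OrdConnected) :
    ∃ ν : ℕ → ℝ → ℝ, (∀ m, Continuous (ν m)) ∧
      (∀ m, ∀ y ∈ Set.Icc (-1 : ℝ) 1, ν m y ∈ Set.Icc (0 : ℝ) 1) ∧
      ∀ y, Tendsto (fun m => ν m y) atTop (𝓝 (V.indicator 1 y)) := by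
  classical
  let up : ℝ → ℝ := (upperClosure V : Set ℝ).indicator 1
  let dn : ℝ → ℝ := (lowerClosure V : Set ℝ)ᶜ.indicator 1
  have hup : Monotone up := fun x y hxy => by
    by_cases hx : x ∈ upperClosure V
    · simp [up, hx, (upperClosure V).upper hxy hx]
    · exact (Set.indicator_of_notMem hx 1).trans_le (Set.indicator_nonneg (by simp) y)
  have hdn : Monotone dn := fun x y hxy => by
    by_cases hy : y ∈ lowerClosure V
    · simp [dn, hy, (lowerClosure V).lower hxy hy]
    · have h1 : dn y = 1 := Set.indicator_of_mem (s := (lowerClosure V : Set ℝ)ᶜ) hy 1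
      rw [h1]
      exact Set.indicator_le_self' (by simp) x
  have hbd : ∀ (B : Set ℝ) (x : ℝ), B.indicator (1 : ℝ → ℝ) x ∈ Set.Icc (0 : ℝ) 1 := fun B x =>
    ⟨Set.indicator_nonneg (by simp) x, Set.indicator_le_self' (by simp) x⟩
  obtain ⟨p, hp, hpm, hp0, hp1, hpt⟩ := exists_continuous_monotone_tendsto hup
  obtain ⟨q, hq, hqm, hq0, hq1, hqt⟩ := exists_continuous_monotone_tendsto hdn
  refine ⟨fun m y => p m y * (1 - q m y), fun m => by fun_prop, fun m y hy => ?_, fun y => ?_⟩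
  · have h1 : 0 ≤ p m y := (hbd _ _).1.trans ((hp0 m).ge.trans (hpm m hy.1))
    have h2 : p m y ≤ 1 := (hpm m hy.2).trans ((hp1 m).le.trans (hbd _ _).2)
    have h3 : 0 ≤ q m y := (hbd _ _).1.trans ((hq0 m).ge.trans (hqm m hy.1))
    have h4 : q m y ≤ 1 := (hqm m hy.2).trans ((hq1 m).le.trans (hbd _ _).2)
    exact ⟨mul_nonneg h1 (by linarith), mul_le_one₀ h2 (by linarith) (by linarith)⟩
  · have h : V.indicator 1 y = up y * (1 - dn y) := by
      have hmem : y ∈ V ↔ y ∈ upperClosure V ∧ y ∈ lowerClosure V := by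
        conv_lhs => rw [← hV.upperClosure_inter_lowerClosure]
        rfl
      by_cases h1 : y ∈ upperClosure V <;> by_cases h2 : y ∈ lowerClosure V <;>
        simp [up, dn, Set.indicator, hmem, h1, h2]
    rw [h]
    exact (hpt y).mul (tendsto_const_nhds.sub (hqt y))

/-! ### Weights on the levels -/

/-- The time coordinate `-log₂ (1 - s)` of the level `s < 1`; it turns `f₀₁` into the translation
by `1` above the level `0`. At `s = 1` it takes the junk value `0`. -/
noncomputable def levelTime (s : ℝ) : ℝ := -Real.logb 2 (1 - s)

@[simp] theorem levelTime_zero : levelTime 0 = 0 := by simp [levelTime]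

@[simp] theorem levelTime_one : levelTime 1 = 0 := by simp [levelTime]

theorem levelTime_half : levelTime (1 / 2) = 1 := by
  rw [levelTime, show (1 - 1 / 2 : ℝ) = 2⁻¹ by norm_num, Real.logb_inv, neg_neg]
  exact Real.logb_self_eq_one one_lt_two

theorem levelTime_add_one_div_two {s : ℝ} (hs : s < 1) :
    levelTime ((s + 1) / 2) = levelTime s + 1 := by
  rw [levelTime, levelTime, show 1 - (s + 1) / 2 = (1 - s) / 2 by ring,
    Real.logb_div (by linarith) two_ne_zero, Real.logb_self_eq_one one_lt_two]
  ring

theorem levelTime_strictMonoOn : StrictMonoOn levelTime (Set.Iio 1) := fun s hs t ht hst =>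
  neg_lt_neg (Real.logb_lt_logb one_lt_two (sub_pos.2 ht) (by linarith))

theorem levelTime_nonpos {s : ℝ} (hs : s ≤ 0) : levelTime s ≤ 0 :=
  (levelTime_strictMonoOn.monotoneOn (hs.trans_lt one_pos) (Set.mem_Iio.2 one_pos) hs).trans_eq
    levelTime_zero

theorem one_sub_rpow_levelTime {s : ℝ} (hs : s < 1) : 1 - (2 : ℝ) ^ (-levelTime s) = s := by
  rw [levelTime, neg_neg, Real.rpow_logb two_pos (by norm_num) (by linarith)]
  ring

theorem continuousAt_levelTime {s : ℝ} (hs : s < 1) : ContinuousAt levelTime s := by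
  have h : 1 - s ≠ 0 := by linarith
  unfold levelTime Real.logb
  exact (((continuousAt_const.sub continuousAt_id).log h).div_const _).neg

theorem tendsto_levelTime : Tendsto levelTime (𝓝[<] 1) atTop := by
  have h : Tendsto (fun s : ℝ => 1 - s) (𝓝[<] 1) (𝓝[>] 0) := by
    refine tendsto_nhdsWithin_iff.2 ⟨?_, ?_⟩
    · exact (Continuous.tendsto' (by fun_prop) 1 0 (by simp)).mono_left nhdsWithin_le_nhds
    · filter_upwards [self_mem_nhdsWithin] with s hs
      exact sub_pos.2 (Set.mem_Iio.1 hs)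
  refine tendsto_neg_atBot_atTop.comp ?_
  exact (Real.tendsto_logb_nhdsGT_zero one_lt_two).comp h

/-- Periodic weights approximating the indicator of an interval `V` of levels. The levels `0` and
`1 / 2` lie on the same orbit, so they share the value of the weight; the summand with `χ` takes
care of them. -/
theorem exists_periodic_weight {V : Set ℝ} (hV : V.OrdConnected) :
    ∃ μ : ℕ → ℝ → ℝ, (∀ m, Continuous (μ m)) ∧ (∀ m t, μ m t ∈ Set.Icc (0 : ℝ) 1) ∧
      (∀ m t, μ m (t + 1) = μ m t) ∧
      ∀ s ∈ Set.Icc (0 : ℝ) (1 / 2), (s = 0 → (1 / 2 : ℝ) ∉ V) → (s = 1 / 2 → (0 : ℝ) ∉ V) →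
        Tendsto (fun m => μ m (levelTime s)) atTop (𝓝 (V.indicator 1 s)) := by
  classical
  obtain ⟨ν, hνc, hνI, hνt⟩ := exists_continuous_tendsto_indicator hV
  let χ : ℝ := if (0 : ℝ) ∈ V ∨ (1 / 2 : ℝ) ∈ V then 1 else 0
  have hχ : χ ∈ Set.Icc (0 : ℝ) 1 := by
    simp only [χ]; split_ifs <;> simp
  let w : ℕ → ℝ → ℝ := fun m y =>
    |1 - 2 * y| ^ m * χ + (1 - |1 - 2 * y| ^ m) * ν m (1 - (2 : ℝ) ^ (-y))
  have hw0 : ∀ m, w m 0 = χ := fun m => by simp [w]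
  have hw1 : ∀ m, w m 1 = χ := fun m => by simp [w]; norm_num
  have hwc : ∀ m, Continuous (w m) := fun m => by
    have := hνc m
    have h2 : Continuous fun y : ℝ => (2 : ℝ) ^ (-y) :=
      continuous_const.rpow continuous_neg fun _ => Or.inl two_ne_zero
    fun_prop
  refine ⟨fun m t => w m (Int.fract t), fun m => ?_, fun m t => ?_, fun m t => ?_, ?_⟩
  · exact (hwc m).continuousOn.comp_fract'' ((hw0 m).trans (hw1 m).symm)
  · have h0 := Int.fract_nonneg t
    have h1 := (Int.fract_lt_one t).le
    simp only [w]
    generalize Int.fract t = y at h0 h1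
    have h2 : (2 : ℝ) ^ (-y) ≤ 1 := Real.rpow_le_one_of_one_le_of_nonpos one_le_two (by linarith)
    have h3 : 0 < (2 : ℝ) ^ (-y) := Real.rpow_pos_of_pos two_pos _
    have h4 := hνI m (1 - (2 : ℝ) ^ (-y)) ⟨by linarith, by linarith⟩
    have h5 : |1 - 2 * y| ^ m ≤ 1 :=
      pow_le_one₀ (abs_nonneg _) (abs_le.2 ⟨by linarith, by linarith⟩)
    have h6 : 0 ≤ |1 - 2 * y| ^ m := by positivity
    exact (convex_Icc (0 : ℝ) 1) hχ h4 h6 (by linarith) (by ring)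
  · simp only [Int.fract_add_one]
  · intro s hs h0 h1
    rcases hs.1.eq_or_lt with rfl | hs0
    · have h0 := h0 rfl
      simp only [levelTime_zero, Int.fract_zero, hw0]
      have : χ = V.indicator 1 0 := by simp only [χ, Set.indicator, h0, or_false, Pi.one_apply]
      rw [this]
      exact tendsto_const_nhds
    rcases hs.2.eq_or_lt with rfl | hs1
    · have h1 := h1 rfl
      simp only [levelTime_half, Int.fract_one, hw0]
      have : χ = V.indicator 1 (1 / 2) := by
        simp only [χ, Set.indicator, h1, false_or, Pi.one_apply]
      rw [this]
      exact tendsto_const_nhds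
    have hs2 : s < 1 := by linarith
    have ht0 : 0 < levelTime s := by
      simpa using levelTime_strictMonoOn (Set.mem_Iio.2 one_pos) hs2 hs0
    have ht1 : levelTime s < 1 := by
      exact (levelTime_strictMonoOn hs2 (Set.mem_Iio.2 (by norm_num : (1 / 2 : ℝ) < 1))
        hs1).trans_eq levelTime_half
    simp only [Int.fract_eq_self.2 ⟨ht0.le, ht1⟩, w, one_sub_rpow_levelTime hs2]
    have hpow := tendsto_pow_atTop_nhds_zero_of_lt_one (abs_nonneg (1 - 2 * levelTime s))
      (abs_lt.2 ⟨by linarith, by linarith⟩)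
    simpa using (hpow.mul_const χ).add (((tendsto_const_nhds (x := (1 : ℝ))).sub hpow).mul (hνt s))

/-! ### Mixtures with priorities -/

/-- The mixture of `p 0, …, p (M - 1)` and `r` in which `p 0` has weight `μ 0`, and a share `μ n`
of the weight left over by `p 0, …, p (n - 1)` goes to `p n`; the rest goes to `r`. -/
noncomputable def priorityMix : ℕ → (ℕ → ℝ) → (ℕ → ℝ) → ℝ → ℝ
  | 0, _, _, r => r
  | M + 1, μ, p, r => μ 0 * p 0 +
      (1 - μ 0) * priorityMix M (fun n => μ (n + 1)) (fun n => p (n + 1)) r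

theorem priorityMix_mem (M : ℕ) {μ p : ℕ → ℝ} {r : ℝ} {C : Set ℝ} (hC : Convex ℝ C)
    (hμ : ∀ n, μ n ∈ Set.Icc (0 : ℝ) 1) (hp : ∀ n, p n ∈ C) (hr : r ∈ C) :
    priorityMix M μ p r ∈ C := by
  induction M generalizing μ p with
  | zero => exact hr
  | succ M ih =>
    exact hC (hp 0) (ih (fun n => hμ (n + 1)) fun n => hp (n + 1)) (hμ 0).1
      (by linarith [(hμ 0).2]) (by ring)

theorem priorityMix_lt (M : ℕ) {μ p p' : ℕ → ℝ} {r r' : ℝ}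
    (hμ : ∀ n, μ n ∈ Set.Icc (0 : ℝ) 1) (hp : ∀ n, p n < p' n) (hr : r < r') :
    priorityMix M μ p r < priorityMix M μ p' r' := by
  induction M generalizing μ p p' with
  | zero => exact hr
  | succ M ih =>
    have h1 := ih (fun n => hμ (n + 1)) fun n => hp (n + 1)
    obtain ⟨h2, h3⟩ := hμ 0
    have h4 := hp 0
    simp only [priorityMix]
    rcases h2.eq_or_lt with h | h
    · rw [← h]; linarith
    · exact add_lt_add_of_lt_of_le (mul_lt_mul_of_pos_left h4 h)
        (mul_le_mul_of_nonneg_left h1.le (by linarith))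

theorem continuous_priorityMix {Z : Type*} [TopologicalSpace Z] (M : ℕ) {μ p : Z → ℕ → ℝ}
    {r : Z → ℝ} (hμ : ∀ n, Continuous fun z => μ z n) (hp : ∀ n, Continuous fun z => p z n)
    (hr : Continuous r) : Continuous fun z => priorityMix M (μ z) (p z) (r z) := by
  induction M generalizing μ p with
  | zero => exact hr
  | succ M ih =>
    exact ((hμ 0).mul (hp 0)).add ((continuous_const.sub (hμ 0)).mul
      (ih (fun n => hμ (n + 1)) fun n => hp (n + 1)))

theorem abs_priorityMix_sub_le {M n : ℕ} (hn : n < M) {μ p : ℕ → ℝ} {r : ℝ}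
    (hμ : ∀ n, μ n ∈ Set.Icc (0 : ℝ) 1) (hp : ∀ n, p n ∈ Set.Icc (-1 : ℝ) 1)
    (hr : r ∈ Set.Icc (-1 : ℝ) 1) :
    |priorityMix M μ p r - p n| ≤ 2 * (1 - μ n) + 2 * ∑ j ∈ Finset.range n, μ j := by
  induction M generalizing μ p n with
  | zero => omega
  | succ M ih =>
    have hm := priorityMix_mem M (convex_Icc (-1 : ℝ) 1) (fun n => hμ (n + 1))
      (fun n => hp (n + 1)) hr
    have hd : ∀ x ∈ Set.Icc (-1 : ℝ) 1, ∀ y ∈ Set.Icc (-1 : ℝ) 1, |x - y| ≤ 2 := fun x hx y hy =>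
      abs_le.2 ⟨by linarith [hx.1, hy.2], by linarith [hx.2, hy.1]⟩
    obtain ⟨h0, h1⟩ := hμ 0
    simp only [priorityMix]
    cases n with
    | zero =>
      have h2 := mul_le_mul_of_nonneg_left (hd _ hm _ (hp 0)) (sub_nonneg.2 h1)
      rw [← abs_of_nonneg (sub_nonneg.2 h1), ← abs_mul, abs_of_nonneg (sub_nonneg.2 h1)] at h2
      simp only [Finset.range_zero, Finset.sum_empty]
      refine (le_of_eq ?_).trans (h2.trans (by linarith))
      congr 1; ring
    | succ n =>
      have h2 := mul_le_mul_of_nonneg_left (hd _ (hp 0) _ (hp (n + 1))) h0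
      have h3 := ih (n := n) (by omega) (fun n => hμ (n + 1)) fun n => hp (n + 1)
      rw [Finset.sum_range_succ']
      set X := priorityMix M (fun n => μ (n + 1)) (fun n => p (n + 1)) r
      have h4 : μ 0 * p 0 + (1 - μ 0) * X - p (n + 1) =
          μ 0 * (p 0 - p (n + 1)) + (1 - μ 0) * (X - p (n + 1)) := by ring
      have h5 : (1 - μ 0) * |X - p (n + 1)| ≤ |X - p (n + 1)| :=
        mul_le_of_le_one_left (abs_nonneg _) (by linarith)
      rw [h4]
      refine (abs_add_le _ _).trans ?_
      rw [abs_mul, abs_mul, abs_of_nonneg h0, abs_of_nonneg (sub_nonneg.2 h1)]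
      linarith

/-! ### Interpolating a sequence of functions -/

/-- The piecewise linear interpolation in `u` of a sequence of functions `X 0, X 1, …`, placed at
`u = 0, 1, …`; constant for `u ≤ 0`. -/
noncomputable def stageInterp {Z : Type*} (X : ℕ → Z → ℝ) (u : ℝ) (z : Z) : ℝ :=
  X 0 z + ∑ m ∈ Finset.range ⌈u⌉₊, max 0 (min 1 (u - m)) * (X (m + 1) z - X m z)

theorem stageInterp_eq {Z : Type*} (X : ℕ → Z → ℝ) {u : ℝ} {N : ℕ} (hN : u ≤ N) (z : Z) :
    stageInterp X u z =
      X 0 z + ∑ m ∈ Finset.range N, max 0 (min 1 (u - m)) * (X (m + 1) z - X m z) := by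
  unfold stageInterp
  congr 1
  refine Finset.sum_subset (Finset.range_mono (Nat.ceil_le.2 hN)) fun m _ hm => ?_
  have h : u ≤ m := Nat.ceil_le.1 (by simpa using hm)
  rw [max_eq_left ((min_le_right _ _).trans (by linarith)), zero_mul]

theorem stageInterp_of_nonpos {Z : Type*} (X : ℕ → Z → ℝ) {u : ℝ} (hu : u ≤ 0) (z : Z) :
    stageInterp X u z = X 0 z := by
  simp [stageInterp_eq X (N := 0) (by simpa using hu)]

theorem stageInterp_of_mem {Z : Type*} (X : ℕ → Z → ℝ) {u : ℝ} {M : ℕ} (h0 : M ≤ u)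
    (h1 : u ≤ M + 1) (z : Z) :
    stageInterp X u z = (M + 1 - u) * X M z + (u - M) * X (M + 1) z := by
  rw [stageInterp_eq X (N := M + 1) (by push_cast; exact h1), Finset.sum_range_succ]
  have h : ∀ m ∈ Finset.range M, max 0 (min 1 (u - m)) * (X (m + 1) z - X m z) =
      X (m + 1) z - X m z := fun m hm => by
    have h2 : (m : ℝ) + 1 ≤ M := by exact_mod_cast Finset.mem_range.1 hm
    rw [min_eq_left (by linarith), max_eq_right zero_le_one, one_mul]
  rw [Finset.sum_congr rfl h, Finset.sum_range_sub (fun m => X m z), min_eq_right (by linarith),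
    max_eq_right (by linarith)]
  ring

theorem continuous_stageInterp {Z : Type*} [TopologicalSpace Z] {X : ℕ → Z → ℝ}
    (hX : ∀ m, Continuous (X m)) : Continuous fun w : ℝ × Z => stageInterp X w.1 w.2 := by
  rw [continuous_iff_continuousAt]
  rintro ⟨u, z⟩
  obtain ⟨N, hN⟩ := exists_nat_gt u
  have hc : Continuous fun w : ℝ × Z => X 0 w.2 + ∑ m ∈ Finset.range N,
      max 0 (min 1 (w.1 - m)) * (X (m + 1) w.2 - X m w.2) := by fun_prop
  refine hc.continuousAt.congr ?_
  filter_upwards [(continuous_fst.tendsto (u, z)).eventually (gt_mem_nhds hN)] with w hw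
  exact (stageInterp_eq X hw.le w.2).symm

theorem abs_stageInterp_sub_le {Z : Type*} {X : ℕ → Z → ℝ} {z : Z}
    (hX : ∀ m, |X (m + 1) z - X m z| ≤ 2) {u u' : ℝ} (hu : 0 ≤ u) (huu' : u ≤ u')
    (hu' : u' ≤ u + 1) : |stageInterp X u' z - stageInterp X u z| ≤ 2 * (u' - u) := by
  have cell : ∀ (M : ℕ) (v v' : ℝ), M ≤ v → v ≤ v' → v' ≤ M + 1 →
      |stageInterp X v' z - stageInterp X v z| ≤ 2 * (v' - v) := fun M v v' h1 h2 h3 => by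
    rw [stageInterp_of_mem X h1 (h2.trans h3), stageInterp_of_mem X (h1.trans h2) h3,
      show (M + 1 - v') * X M z + (v' - M) * X (M + 1) z -
        ((M + 1 - v) * X M z + (v - M) * X (M + 1) z) = (X (M + 1) z - X M z) * (v' - v) by ring,
      abs_mul, abs_of_nonneg (sub_nonneg.2 h2)]
    exact mul_le_mul_of_nonneg_right (hX M) (sub_nonneg.2 h2)
  have h1 := Nat.floor_le hu
  have h2 := (Nat.lt_floor_add_one u).le
  rcases le_total u' (⌊u⌋₊ + 1) with h | h
  · exact cell _ _ _ h1 huu' h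
  · have h3 := cell _ _ _ h1 h2 le_rfl
    have h4 := cell (⌊u⌋₊ + 1) (⌊u⌋₊ + 1) u' (by push_cast; rfl) h (by push_cast; linarith)
    refine (abs_sub_le _ (stageInterp X (⌊u⌋₊ + 1) z) _).trans ?_
    linarith

/-! ### The family of horizontal coordinates -/

theorem exists_continuous_strictMono_tendsto {a : ℝ → ℝ} (ha : Monotone a) (ha0 : a (-1) = -1)
    (ha1 : a 1 = 1) :
    ∃ p : ℕ → ℝ → ℝ, (∀ m, Continuous (p m)) ∧ (∀ m, StrictMono (p m)) ∧
      (∀ m, p m (-1) = -1) ∧ (∀ m, p m 1 = 1) ∧ ∀ x, Tendsto (fun m => p m x) atTop (𝓝 (a x)) := by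
  obtain ⟨p, hpc, hpm, hp0, hp1, hpt⟩ := exists_continuous_monotone_tendsto ha
  have hc0 : ∀ m : ℕ, (0 : ℝ) < 1 / (m + 1) := fun m => Nat.one_div_pos_of_nat
  have hc1 : ∀ m : ℕ, (1 : ℝ) / (m + 1) ≤ 1 := fun m => by
    rw [div_le_one (by positivity)]; linarith [(m.cast_nonneg : (0 : ℝ) ≤ m)]
  refine ⟨fun m x => (1 - 1 / ((m : ℝ) + 1)) * p m x + 1 / ((m : ℝ) + 1) * x, fun m => ?_,
    fun m x y hxy => ?_, fun m => ?_, fun m => ?_, fun x => ?_⟩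
  · have := hpc m
    fun_prop
  · exact add_lt_add_of_le_of_lt
      (mul_le_mul_of_nonneg_left (hpm m hxy.le) (sub_nonneg.2 (hc1 m)))
      (mul_lt_mul_of_pos_left hxy (hc0 m))
  · simp only [hp0, ha0]; ring
  · simp only [hp1, ha1]; ring
  · have hc := tendsto_one_div_add_atTop_nhds_zero_nat (𝕜 := ℝ)
    simpa using (((tendsto_const_nhds (x := (1 : ℝ))).sub hc).mul (hpt x)).add (hc.mul_const x)

/-- The stages alternate between approximations of `a n` (even stages) and of `b n` (odd stages)
on the levels of `V n`. -/
theorem exists_stages {V : ℕ → Set ℝ} (hV : ∀ n, (V n).OrdConnected)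
    (hVsub : ∀ n, V n ⊆ Set.Icc 0 (1 / 2)) (hVdisj : Pairwise fun m n => Disjoint (V m) (V n))
    (hVend : ∀ m n, (0 : ℝ) ∈ V m → (1 / 2 : ℝ) ∉ V n) {a b : ℕ → ℝ → ℝ}
    (ha : ∀ n, Monotone (a n)) (ha0 : ∀ n, a n (-1) = -1) (ha1 : ∀ n, a n 1 = 1)
    (hb : ∀ n, Monotone (b n)) (hb0 : ∀ n, b n (-1) = -1) (hb1 : ∀ n, b n 1 = 1) :
    ∃ X : ℕ → ℝ × ℝ → ℝ, (∀ M, Continuous (X M)) ∧ (∀ M t, StrictMono fun r => X M (t, r)) ∧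
      (∀ M t, X M (t, -1) = -1) ∧ (∀ M t, X M (t, 1) = 1) ∧ (∀ t r, X 0 (t, r) = r) ∧
      (∀ M t r, X M (t + 1, r) = X M (t, r)) ∧
      ∀ n, ∀ s ∈ V n, ∀ r ∈ Set.Icc (-1 : ℝ) 1,
        Tendsto (fun M => X M (levelTime s, r) - if Even M then a n r else b n r) atTop (𝓝 0) := by
  choose p hpc hpm hp0 hp1 hpt using fun n =>
    exists_continuous_strictMono_tendsto (ha n) (ha0 n) (ha1 n)
  choose q hqc hqm hq0 hq1 hqt using fun n =>
    exists_continuous_strictMono_tendsto (hb n) (hb0 n) (hb1 n)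
  choose μ hμc hμI hμp hμt using fun n => exists_periodic_weight (hV n)
  let P : ℕ → ℕ → ℝ → ℝ := fun M n => if Even M then p n M else q n M
  have hPc : ∀ M n, Continuous (P M n) := fun M n => by
    simp only [P]; split_ifs
    exacts [hpc n M, hqc n M]
  have hPm : ∀ M n, StrictMono (P M n) := fun M n => by
    simp only [P]; split_ifs
    exacts [hpm n M, hqm n M]
  have hP0 : ∀ M n, P M n (-1) = -1 := fun M n => by
    simp only [P]; split_ifs
    exacts [hp0 n M, hq0 n M]
  have hP1 : ∀ M n, P M n 1 = 1 := fun M n => by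
    simp only [P]; split_ifs
    exacts [hp1 n M, hq1 n M]
  have hPt : ∀ n r, Tendsto (fun M => P M n r - if Even M then a n r else b n r) atTop (𝓝 0) := by
    intro n r
    have h1 : Tendsto (fun M => |p n M r - a n r| + |q n M r - b n r|) atTop (𝓝 0) := by
      simpa using ((hpt n r).sub_const (a n r)).abs.add ((hqt n r).sub_const (b n r)).abs
    refine squeeze_zero_norm (fun M => ?_) h1
    simp only [P, Real.norm_eq_abs]
    split_ifs
    · exact le_add_of_nonneg_right (abs_nonneg _)
    · exact le_add_of_nonneg_left (abs_nonneg _)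
  refine ⟨fun M w => priorityMix M (fun n => μ n M w.1) (fun n => P M n w.2) w.2, fun M => ?_,
    fun M t r r' hr => ?_, fun M t => ?_, fun M t => ?_, fun t r => rfl, fun M t r => ?_,
    fun n s hs r hr => ?_⟩
  · exact continuous_priorityMix M (fun n => (hμc n M).comp continuous_fst)
      (fun n => (hPc M n).comp continuous_snd) continuous_snd
  · exact priorityMix_lt M (fun n => hμI n M t) (fun n => hPm M n hr) hr
  · exact Set.mem_singleton_iff.1 (priorityMix_mem M (convex_singleton _) (fun n => hμI n M t)
      (fun n => hP0 M n) rfl)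
  · exact Set.mem_singleton_iff.1 (priorityMix_mem M (convex_singleton _) (fun n => hμI n M t)
      (fun n => hP1 M n) rfl)
  · simp only [hμp]
  · have hμt' : ∀ j, Tendsto (fun M => μ j M (levelTime s)) atTop (𝓝 ((V j).indicator 1 s)) :=
      fun j => hμt j s (hVsub n hs) (fun h => hVend n j (h ▸ hs))
        (fun h h' => hVend j n h' (h ▸ hs))
    have hn : Tendsto (fun M => μ n M (levelTime s)) atTop (𝓝 1) := by
      simpa [hs] using hμt' n
    have hj : ∀ j ∈ Finset.range n, Tendsto (fun M => μ j M (levelTime s)) atTop (𝓝 0) := by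
      intro j hj
      have : s ∉ V j := fun h =>
        Set.disjoint_left.1 (hVdisj (Finset.mem_range.1 hj).ne) h hs
      simpa [this] using hμt' j
    have hbound : Tendsto (fun M => 2 * (1 - μ n M (levelTime s)) +
        2 * ∑ j ∈ Finset.range n, μ j M (levelTime s)) atTop (𝓝 0) := by
      simpa using (((tendsto_const_nhds (x := (1 : ℝ))).sub hn).const_mul 2).add
        ((tendsto_finsetSum _ hj).const_mul 2)
    have hdiff : Tendsto (fun M => priorityMix M (fun n => μ n M (levelTime s))
        (fun n => P M n r) r - P M n r) atTop (𝓝 0) := by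
      refine squeeze_zero_norm' ?_ hbound
      filter_upwards [eventually_gt_atTop n] with M hM
      exact abs_priorityMix_sub_le hM (fun j => hμI j M _) (fun j =>
        ⟨(hP0 M j).ge.trans ((hPm M j).monotone hr.1),
          ((hPm M j).monotone hr.2).trans (hP1 M j).le⟩) hr
    simpa using hdiff.add (hPt n r)

/-- The stage reached at time `t` is `√(t - 1)`: it tends to infinity with steps tending to `0`, so
that the horizontal coordinate moves less and less in each unit of time. -/
theorem exists_horizontal_family {V : ℕ → Set ℝ} (hV : ∀ n, (V n).OrdConnected)
    (hVsub : ∀ n, V n ⊆ Set.Icc 0 (1 / 2)) (hVdisj : Pairwise fun m n => Disjoint (V m) (V n))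
    (hVend : ∀ m n, (0 : ℝ) ∈ V m → (1 / 2 : ℝ) ∉ V n) {a b : ℕ → ℝ → ℝ}
    (ha : ∀ n, Monotone (a n)) (ha0 : ∀ n, a n (-1) = -1) (ha1 : ∀ n, a n 1 = 1)
    (hb : ∀ n, Monotone (b n)) (hb0 : ∀ n, b n (-1) = -1) (hb1 : ∀ n, b n 1 = 1)
    (hab : ∀ n, ∀ r ∈ Set.Icc (-1 : ℝ) 1, a n r ≤ b n r) :
    ∃ G : ℝ → ℝ → ℝ, Continuous (Function.uncurry G) ∧ (∀ t, StrictMono (G t)) ∧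
      (∀ t, G t (-1) = -1) ∧ (∀ t, G t 1 = 1) ∧ (∀ t ≤ 1, ∀ r, G t r = r) ∧
      (∀ ε > 0, ∃ B, ∀ t ≥ B, ∀ r ∈ Set.Icc (-1 : ℝ) 1, |G (t + 1) r - G t r| ≤ ε) ∧
      ∀ n, ∀ s ∈ V n, ∀ r ∈ Set.Icc (-1 : ℝ) 1, ∀ y,
        MapClusterPt y atTop (fun k : ℕ => G (levelTime s + k) r) ↔
          y ∈ Set.Icc (a n r) (b n r) := by
  obtain ⟨X, hXc, hXm, hX0, hX1, hXz, hXp, hXt⟩ :=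
    exists_stages hV hVsub hVdisj hVend ha ha0 ha1 hb hb0 hb1
  let σ : ℝ → ℝ := fun t => √(t - 1)
  have hσ0 : ∀ t, 0 ≤ σ t := fun t => Real.sqrt_nonneg _
  have hσmono : Monotone σ := fun t t' h => Real.sqrt_le_sqrt (by linarith)
  have hσc : Continuous σ := by fun_prop
  have hσtop : Tendsto σ atTop atTop :=
    Real.tendsto_sqrt_atTop.comp (tendsto_atTop_add_const_right _ (-1) tendsto_id)
  have hσsq : ∀ t, 1 ≤ t → σ t ^ 2 = t - 1 := fun t ht => Real.sq_sqrt (by linarith)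
  -- `(σ (t + 1) - σ t) * (σ (t + 1) + σ t) = 1` for `1 ≤ t`
  have hσstep : ∀ t, 1 ≤ t → 0 < σ t → σ (t + 1) - σ t ≤ 1 / σ t := fun t ht hpos => by
    rw [le_div_iff₀ hpos]
    have h1 := hσsq t ht
    have h2 := hσsq (t + 1) (by linarith)
    have h3 := hσmono (by linarith : t ≤ t + 1)
    have h4 := hσ0 (t + 1)
    nlinarith
  have hXI : ∀ M t, ∀ r ∈ Set.Icc (-1 : ℝ) 1, X M (t, r) ∈ Set.Icc (-1 : ℝ) 1 := fun M t r hr =>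
    ⟨(hX0 M t).ge.trans ((hXm M t).monotone hr.1), ((hXm M t).monotone hr.2).trans (hX1 M t).le⟩
  have hX2 : ∀ t, ∀ r ∈ Set.Icc (-1 : ℝ) 1, ∀ m, |X (m + 1) (t, r) - X m (t, r)| ≤ 2 := by
    intro t r hr m
    obtain ⟨h1, h2⟩ := hXI m t r hr
    obtain ⟨h3, h4⟩ := hXI (m + 1) t r hr
    exact abs_le.2 ⟨by linarith, by linarith⟩
  have hcell : ∀ u : ℝ, 0 ≤ u → ∃ M : ℕ, M ≤ u ∧ u ≤ M + 1 ∧ ∀ z,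
      stageInterp X u z = (M + 1 - u) * X M z + (u - M) * X (M + 1) z := fun u hu =>
    ⟨⌊u⌋₊, Nat.floor_le hu, (Nat.lt_floor_add_one u).le, fun z =>
      stageInterp_of_mem X (Nat.floor_le hu) (Nat.lt_floor_add_one u).le z⟩
  let G : ℝ → ℝ → ℝ := fun t r => stageInterp X (σ t) (t, r)
  have hGp : ∀ t r, G (t + 1) r = stageInterp X (σ (t + 1)) (t, r) := fun t r => by
    simp only [G, stageInterp, hXp]
  have hGstep : ∀ ε > 0, ∃ B, ∀ t ≥ B, ∀ r ∈ Set.Icc (-1 : ℝ) 1, |G (t + 1) r - G t r| ≤ ε := by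
    intro ε hε
    obtain ⟨B, hB⟩ := eventually_atTop.1 (hσtop.eventually_ge_atTop (max 1 (2 / ε)))
    refine ⟨max 1 B, fun t ht r hr => ?_⟩
    have h1 := hB t ((le_max_right _ _).trans ht)
    have h2 : 1 ≤ σ t := (le_max_left _ _).trans h1
    have h3 : 2 / ε ≤ σ t := (le_max_right _ _).trans h1
    have h4 := hσstep t ((le_max_left _ _).trans ht) (by linarith)
    have h5 : 1 / σ t ≤ 1 := (div_le_one (by linarith)).2 h2
    have h6 : 2 * (1 / σ t) ≤ ε := by
      rw [mul_one_div, div_le_iff₀ (by linarith)]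
      rw [div_le_iff₀ hε] at h3
      linarith
    rw [hGp]
    have h7 := abs_stageInterp_sub_le (hX2 t r hr) (hσ0 t) (hσmono (by linarith : t ≤ t + 1))
      (by linarith)
    linarith
  refine ⟨G, ?_, fun t r r' hr => ?_, fun t => ?_, fun t => ?_, fun t ht r => ?_, hGstep, ?_⟩
  · exact (continuous_stageInterp hXc).comp
      ((hσc.comp continuous_fst).prodMk (continuous_id : Continuous fun w : ℝ × ℝ => w))
  · obtain ⟨M, h1, h2, h3⟩ := hcell (σ t) (hσ0 t)
    simp only [G, h3]
    have h4 := hXm M t hr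
    have h5 := hXm (M + 1) t hr
    rcases h1.eq_or_lt with h | h
    · rw [← h]
      simpa using h4
    · exact add_lt_add_of_le_of_lt (mul_le_mul_of_nonneg_left h4.le (by linarith))
        (mul_lt_mul_of_pos_left h5 (by linarith))
  · obtain ⟨M, h1, h2, h3⟩ := hcell (σ t) (hσ0 t)
    simp only [G, h3, hX0]
    ring
  · obtain ⟨M, h1, h2, h3⟩ := hcell (σ t) (hσ0 t)
    simp only [G, h3, hX1]
    ring
  · have : σ t = 0 := Real.sqrt_eq_zero_of_nonpos (by linarith)
    simp only [G, this, stageInterp_of_nonpos X le_rfl, hXz]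
  · intro n s hs r hr y
    have hτ0 : 0 ≤ levelTime s := by
      simpa using levelTime_strictMonoOn.monotoneOn (Set.mem_Iio.2 one_pos)
        (Set.mem_Iio.2 (by linarith [(hVsub n hs).2])) (hVsub n hs).1
    have hτ1 : levelTime s ≤ 1 :=
      (levelTime_strictMonoOn.monotoneOn (Set.mem_Iio.2 (by linarith [(hVsub n hs).2]))
        (Set.mem_Iio.2 (by norm_num)) (hVsub n hs).2).trans_eq levelTime_half
    have hXt := hXt n s hs r hr
    have hab := hab n r hr
    set τ := levelTime s
    have hperiod : ∀ (k : ℕ) M, X M (τ + k, r) = X M (τ, r) := fun k M => by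
      induction k with
      | zero => simp
      | succ k ih => rw [Nat.cast_succ, ← add_assoc, hXp, ih]
    let u : ℕ → ℝ := fun k => G (τ + k) r
    have hu : ∀ k, u k = stageInterp X (σ (τ + k)) (τ, r) := fun k => by
      simp only [u, G, stageInterp, hperiod]
    have htime : Tendsto (fun k : ℕ => τ + k) atTop atTop :=
      tendsto_atTop_add_const_left _ _ tendsto_natCast_atTop_atTop
    have hbounds : ∀ ε > 0, ∀ᶠ k in atTop, u k ∈ Set.Icc (a n r - ε) (b n r + ε) := by
      intro ε hε
      obtain ⟨M₀, hM₀⟩ := eventually_atTop.1 (hXt.eventually (Metric.ball_mem_nhds 0 hε))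
      have hXε : ∀ M ≥ M₀, X M (τ, r) ∈ Set.Icc (a n r - ε) (b n r + ε) := fun M hM => by
        have h1 := hM₀ M hM
        rw [dist_zero_right, Real.norm_eq_abs, abs_lt] at h1
        obtain ⟨h1, h2⟩ := h1
        constructor <;> split_ifs at h1 h2 <;> linarith
      filter_upwards [(hσtop.comp htime).eventually_ge_atTop ((M₀ : ℝ) + 1)] with k hk
      obtain ⟨M, h1, h2, h3⟩ := hcell (σ (τ + k)) (hσ0 _)
      have hM : M₀ ≤ M := by
        have : (M₀ : ℝ) + 1 ≤ M + 1 := hk.trans h2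
        exact_mod_cast (by linarith : (M₀ : ℝ) ≤ M)
      rw [hu, h3]
      exact (convex_Icc _ _) (hXε M hM) (hXε (M + 1) (by omega)) (sub_nonneg.2 h2)
        (sub_nonneg.2 h1) (by ring)
    -- at time `M ^ 2 + 1` the stage `M` has just been reached
    have hvisit : Tendsto (fun M : ℕ => u (M ^ 2 + 1) - if Even M then a n r else b n r) atTop
        (𝓝 0) := by
      have h1 : Tendsto (fun M : ℕ => u (M ^ 2 + 1) - X M (τ, r)) atTop (𝓝 0) := by
        have h2 : Tendsto (fun M : ℕ => 2 * (1 / (M : ℝ))) atTop (𝓝 0) := by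
          simpa using (tendsto_one_div_atTop_nhds_zero_nat (𝕜 := ℝ)).const_mul 2
        refine squeeze_zero_norm' ?_ h2
        filter_upwards [eventually_ge_atTop 1] with M hM
        have hM' : (1 : ℝ) ≤ M := by exact_mod_cast hM
        have h3 := hσsq (τ + (M ^ 2 + 1 : ℕ)) (by push_cast; nlinarith)
        push_cast at h3
        have h4 := hσ0 (τ + ((M : ℝ) ^ 2 + 1))
        have h5 : (M : ℝ) ≤ σ (τ + ((M : ℝ) ^ 2 + 1)) := by nlinarith
        have h6 : σ (τ + ((M : ℝ) ^ 2 + 1)) - M ≤ 1 / M := by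
          rw [le_div_iff₀ (by linarith)]
          nlinarith
        have h7 : 1 / (M : ℝ) ≤ 1 := (div_le_one (by linarith)).2 hM'
        have h8 := abs_stageInterp_sub_le (hX2 τ r hr) M.cast_nonneg h5 (by linarith)
        rw [stageInterp_of_mem X le_rfl (by linarith)] at h8
        rw [hu, Real.norm_eq_abs]
        push_cast
        simp only [sub_self, zero_mul, add_zero, add_sub_cancel_left, one_mul] at h8
        linarith
      simpa using h1.add hXt
    have hfreq : ∀ (c : ℝ), (∃ᶠ M : ℕ in atTop, c = if Even M then a n r else b n r) →
        ∀ ε > 0, ∃ᶠ k in atTop, |u k - c| < ε := by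
      intro c hc ε hε
      have htop : Tendsto (fun M : ℕ => M ^ 2 + 1) atTop atTop :=
        
        tendsto_atTop_mono (fun M => (Nat.le_self_pow two_ne_zero M).trans (Nat.le_succ _))
          tendsto_id
      refine htop.frequently ((hc.and_eventually
        (hvisit.eventually (Metric.ball_mem_nhds 0 hε))).mono ?_)
      rintro M ⟨rfl, h⟩
      simpa [Real.dist_eq] using h
    have hfreqa := hfreq (a n r) (frequently_atTop.2 fun N => ⟨2 * N, by omega, by simp⟩)
    have hfreqb := hfreq (b n r) (frequently_atTop.2 fun N => ⟨2 * N + 1, by omega, by simp⟩)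
    constructor
    · intro hy
      have hclosed : ∀ ε > 0, y ∈ Set.Icc (a n r - ε) (b n r + ε) := fun ε hε =>
        isClosed_Icc.mem_of_mapClusterPt hy (hbounds ε hε)
      exact ⟨le_of_forall_pos_le_add fun ε hε => by linarith [(hclosed ε hε).1],
        le_of_forall_pos_le_add fun ε hε => (hclosed ε hε).2⟩
    · intro hy
      refine mapClusterPt_of_step_tendsto_zero (u := u) ?_
        (fun ε hε => (hfreqa ε hε).mono fun k hk => ?_)
        (fun ε hε => (hfreqb ε hε).mono fun k hk => ?_)
      · rw [Metric.tendsto_atTop]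
        intro ε hε
        obtain ⟨B, hB⟩ := hGstep (ε / 2) (by linarith)
        obtain ⟨N, hN⟩ := eventually_atTop.1 (htime.eventually_ge_atTop B)
        refine ⟨N, fun k hk => ?_⟩
        have h := hB (τ + k) (hN k hk) r hr
        rw [Real.dist_eq, sub_zero]
        simp only [u]
        rw [Nat.cast_succ, ← add_assoc]
        linarith
      · linarith [(abs_lt.1 hk).2, hy.1]
      · linarith [(abs_lt.1 hk).1, hy.2]

/-! ### Rising homeomorphisms of the square -/

/-- The reflection `s ↦ -s` of `J`. -/
def jNeg : J ≃ₜ J where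
  toFun s := ⟨-s, neg_le_neg s.2.2, neg_le.1 s.2.1⟩
  invFun s := ⟨-s, neg_le_neg s.2.2, neg_le.1 s.2.1⟩
  left_inv s := Subtype.ext (neg_neg _)
  right_inv s := Subtype.ext (neg_neg _)
  continuous_toFun := by fun_prop
  continuous_invFun := by fun_prop

@[simp] theorem coe_jNeg (s : J) : (jNeg s : ℝ) = -s := rfl

@[simp] theorem jNeg_jNeg (s : J) : jNeg (jNeg s) = s := jNeg.left_inv s

theorem coe_f01 (s : J) : (f01 s : ℝ) = if 0 ≤ (s : ℝ) then ((s : ℝ) + 1) / 2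
    else if -(1 / 2) ≤ (s : ℝ) then (s : ℝ) + 1 / 2 else 2 * (s : ℝ) + 1 := rfl

theorem coe_f01_of_nonneg {s : J} (hs : 0 ≤ (s : ℝ)) : (f01 s : ℝ) = ((s : ℝ) + 1) / 2 := by
  rw [coe_f01, if_pos hs]

theorem coe_f01_eq_min (s : J) :
    (f01 s : ℝ) = min (2 * (s : ℝ) + 1) (min ((s : ℝ) + 1 / 2) (((s : ℝ) + 1) / 2)) := by
  obtain ⟨h0, h1⟩ := s.2
  rw [coe_f01]
  grind

theorem f01_jNeg_nonneg {s : J} (hs : (s : ℝ) ≤ 1 / 2) : 0 ≤ (f01 (jNeg s) : ℝ) := by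
  rw [coe_f01_eq_min, coe_jNeg]
  exact le_min (by linarith) (le_min (by linarith) (by linarith [s.2.2]))

theorem continuous_f01 : Continuous f01 := by
  refine continuous_induced_rng.2 ?_
  have h : (Subtype.val ∘ f01 : J → ℝ) =
      fun s : J => min (2 * (s : ℝ) + 1) (min (s + 1 / 2) ((s + 1) / 2)) :=
    funext coe_f01_eq_min
  rw [h]
  fun_prop

theorem jNeg_f01_jNeg_f01 (s : J) : jNeg (f01 (jNeg (f01 s))) = s := by
  refine Subtype.ext ?_
  obtain ⟨h0, h1⟩ := s.2
  simp only [coe_jNeg, coe_f01]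
  grind

theorem f01_jNeg_f01 (s : J) : f01 (jNeg (f01 s)) = jNeg s := by
  rw [← jNeg_jNeg (f01 (jNeg (f01 s))), jNeg_f01_jNeg_f01]

/-- `f₀₁` as a homeomorphism: its inverse is its conjugate by `s ↦ -s`. -/
noncomputable def f01Homeo : J ≃ₜ J where
  toFun := f01
  invFun s := jNeg (f01 (jNeg s))
  left_inv := jNeg_f01_jNeg_f01
  right_inv s := by
    rw [f01_jNeg_f01, jNeg_jNeg]
  continuous_toFun := continuous_f01
  continuous_invFun := jNeg.continuous.comp (continuous_f01.comp jNeg.continuous)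

/-- `f₀₂` as a homeomorphism. -/
noncomputable def f02Homeo : (J × J) ≃ₜ (J × J) := (Homeomorph.refl J).prodCongr f01Homeo

theorem f02Homeo_apply (x : J × J) : f02Homeo x = f02 x := rfl

theorem f01_jMin : f01 jMin = jMin := by
  refine Subtype.ext ?_
  simp only [coe_f01, jMin]
  norm_num

theorem f01_jMax : f01 jMax = jMax := by
  refine Subtype.ext ?_
  simp only [coe_f01, jMax]
  norm_num

theorem f02_mem_squareBoundary {x : J × J} (hx : x ∈ squareBoundary) : f02 x ∈ squareBoundary := by
  obtain ⟨r, s⟩ := x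
  rcases hx with h | h | h | h <;> simp only at h <;> subst h
  · exact Or.inl rfl
  · exact Or.inr (Or.inl rfl)
  · exact Or.inr (Or.inr (Or.inl f01_jMin))
  · exact Or.inr (Or.inr (Or.inr f01_jMax))

theorem tendsto_f01_iterate {s : J} (hs : 0 ≤ (s : ℝ)) :
    Tendsto (fun k : ℕ => f01^[k] s) atTop (𝓝 jMax) := by
  have h : ∀ k : ℕ, (f01^[k] s : ℝ) = 1 - (1 - s) * (1 / 2) ^ k := by
    intro k
    induction k with
    | zero => simp
    | succ k ih =>
      have h1 : (1 - (s : ℝ)) * (1 / 2) ^ k ≤ 1 :=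
        mul_le_one₀ (by linarith) (by positivity) (pow_le_one₀ (by norm_num) (by norm_num))
      rw [Function.iterate_succ_apply', coe_f01_of_nonneg (by rw [ih]; linarith), ih, pow_succ]
      ring
  rw [tendsto_subtype_rng]
  simp only [h, jMax]
  simpa using ((tendsto_pow_atTop_nhds_zero_of_lt_one (by norm_num : (0 : ℝ) ≤ 1 / 2)
    (by norm_num)).const_mul (1 - (s : ℝ))).const_sub 1

theorem continuous_orderIso_symm {Z : Type*} [TopologicalSpace Z] {E : Z → J ≃o J}
    (hE : Continuous fun w : Z × J => E w.1 w.2) :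
    Continuous fun w : Z × J => (E w.1).symm w.2 := by
  rw [continuous_iff_continuousAt]
  rintro ⟨z, x⟩
  have hc : ∀ c : J, Continuous fun w : Z × J => E w.1 c := fun c =>
    hE.comp (continuous_fst.prodMk continuous_const)
  refine tendsto_order.2 ⟨fun c h => ?_, fun c h => ?_⟩
  · have h' : E z c < x := (E z).lt_symm_apply.1 h
    filter_upwards [(isOpen_lt (hc c) continuous_snd).mem_nhds h'] with w hw
    exact (E w.1).lt_symm_apply.2 hw
  · have h' : x < E z c := (E z).symm_apply_lt.1 h
    filter_upwards [(isOpen_lt continuous_snd (hc c)).mem_nhds h'] with w hw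
    exact (E w.1).symm_apply_lt.2 hw

/-- The homeomorphism that carries the curve `s ↦ (G (levelTime s) y, s)` into the curve
`s ↦ (G (levelTime s + 1) y, f₀₁ s)`, for every `y`. It is continuous at the top edge because `G`
hardly moves in one unit of time when the time is large. -/
theorem exists_homeo_of_horizontal_family {G : ℝ → ℝ → ℝ} (hGc : Continuous (Function.uncurry G))
    (hGm : ∀ t, StrictMono (G t)) (hG0 : ∀ t, G t (-1) = -1) (hG1 : ∀ t, G t 1 = 1)
    (hGid : ∀ t ≤ 1, ∀ r, G t r = r)
    (hGstep : ∀ ε > 0, ∃ B, ∀ t ≥ B, ∀ r ∈ Set.Icc (-1 : ℝ) 1, |G (t + 1) r - G t r| ≤ ε) :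
    ∃ F : (J × J) ≃ₜ (J × J), (∀ x, (F x).2 = f01 x.2) ∧
      ∀ x y s : J, (x : ℝ) = G (levelTime s) y → ((F (x, s)).1 : ℝ) = G (levelTime s + 1) y := by
  let g : ℝ → J → J := fun t r =>
    ⟨G t r, (hG0 t).ge.trans ((hGm t).monotone r.2.1), ((hGm t).monotone r.2.2).trans (hG1 t).le⟩
  have hgm : ∀ t, StrictMono (g t) := fun t r r' h => hGm t h
  have hgs : ∀ t, Function.Surjective (g t) := fun t x => by
    have hcont : ContinuousOn (G t) (Set.Icc (-1) 1) :=
      (hGc.comp (Continuous.prodMk_right t)).continuousOn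
    have h := intermediate_value_Icc (by norm_num : (-1 : ℝ) ≤ 1) hcont
    rw [hG0, hG1] at h
    obtain ⟨r, hr, hrx⟩ := h x.2
    exact ⟨⟨r, hr⟩, Subtype.ext hrx⟩
  let E : ℝ → J ≃o J := fun t => (hgm t).orderIsoOfSurjective (g t) (hgs t)
  have hE : ∀ t (r : J), (E t r : ℝ) = G t r := fun t r => rfl
  have hEc : Continuous fun w : ℝ × J => E w.1 w.2 := by
    refine continuous_induced_rng.2 ?_
    exact hGc.comp (continuous_fst.prodMk (continuous_subtype_val.comp continuous_snd))
  have hEid : ∀ t ≤ 1, ∀ r, E t r = r := fun t ht r => Subtype.ext (hGid t ht r)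
  let Φ : (J × J) ≃ (J × J) :=
    { toFun := fun x => (E (levelTime x.2 + 1) ((E (levelTime x.2)).symm x.1), f01Homeo x.2)
      invFun := fun x => (E (levelTime (f01Homeo.symm x.2))
        ((E (levelTime (f01Homeo.symm x.2) + 1)).symm x.1), f01Homeo.symm x.2)
      left_inv := fun x => by simp
      right_inv := fun x => by simp }
  have hΦc : Continuous Φ := by
    refine Continuous.prodMk ?_ (f01Homeo.continuous.comp continuous_snd)
    rw [continuous_iff_continuousAt]
    rintro ⟨r, s⟩
    rcases s.2.2.lt_or_eq with hs | hs
    · have h1 : ContinuousAt (fun x : J × J => levelTime x.2) (r, s) :=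
        ContinuousAt.comp (f := fun x : J × J => (x.2 : ℝ)) (continuousAt_levelTime hs)
          (by fun_prop)
      have h2 : ContinuousAt (fun x : J × J => (E (levelTime x.2)).symm x.1) (r, s) :=
        ContinuousAt.comp (f := fun x : J × J => (levelTime x.2, x.1))
          (continuous_orderIso_symm hEc).continuousAt (h1.prodMk continuousAt_fst)
      exact ContinuousAt.comp
        (f := fun x : J × J => (levelTime x.2 + 1, (E (levelTime x.2)).symm x.1))
        hEc.continuousAt ((h1.add continuousAt_const).prodMk h2)
    · -- at the top edge the displacement tends to zero
      have htop : ∀ x y : J, (y : ℝ) = 1 → E (levelTime y + 1) ((E (levelTime y)).symm x) = x := by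
        intro x y hy
        rw [hy, levelTime_one, hEid (0 + 1) (by norm_num),
          ← hEid 0 zero_le_one ((E 0).symm x), OrderIso.apply_symm_apply]
      rw [Metric.continuousAt_iff']
      intro ε hε
      obtain ⟨B, hB⟩ := hGstep (ε / 2) (by linarith)
      obtain ⟨l, hl, hlB⟩ := (mem_nhdsLT_iff_exists_Ioo_subset).1
        (tendsto_levelTime.eventually_ge_atTop B)
      have hnear : ∀ᶠ x : J × J in 𝓝 (r, s), l < (x.2 : ℝ) := by
        have hc : Continuous fun x : J × J => (x.2 : ℝ) := by fun_prop
        exact (hc.tendsto (r, s)).eventually (lt_mem_nhds (by rw [hs]; exact hl))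
      filter_upwards [hnear, (continuous_fst.tendsto (r, s)).eventually
        (Metric.ball_mem_nhds r (half_pos hε))] with x hx hxr
      rw [htop r s hs]
      refine (dist_triangle _ x.1 _).trans_lt ?_
      suffices h : dist (E (levelTime x.2 + 1) ((E (levelTime x.2)).symm x.1)) x.1 ≤ ε / 2 by
        have h' : dist x.1 r < ε / 2 := hxr
        linarith
      rcases x.2.2.2.lt_or_eq with hx1 | hx1
      · obtain ⟨y, hy⟩ := (E (levelTime x.2)).surjective x.1
        rw [← hy, OrderIso.symm_apply_apply, Subtype.dist_eq, Real.dist_eq, hE, hE]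
        exact hB _ (hlB ⟨hx, hx1⟩) y y.2
      · rw [htop _ _ hx1, dist_self]
        linarith
  refine ⟨hΦc.homeoOfEquivCompactToT2, fun x => rfl, fun x y s hxy => ?_⟩
  have hx : x = E (levelTime s) y := Subtype.ext hxy
  have h : (hΦc.homeoOfEquivCompactToT2 (x, s)).1 =
    E (levelTime s + 1) ((E (levelTime s)).symm x) := rfl
  rw [h, hx, OrderIso.symm_apply_apply, hE]

/-- The one-sided form of the theorem: a rising homeomorphism that only differs from `f₀₂` above
the level `0` and has prescribed `ω`-limit sets. -/
theorem exists_homeo_omegaLim {V : ℕ → Set ℝ} (hV : ∀ n, (V n).OrdConnected)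
    (hVsub : ∀ n, V n ⊆ Set.Icc 0 (1 / 2)) (hVdisj : Pairwise fun m n => Disjoint (V m) (V n))
    (hVend : ∀ m n, (0 : ℝ) ∈ V m → (1 / 2 : ℝ) ∉ V n) {a b : ℕ → ℝ → ℝ}
    (ha : ∀ n, Monotone (a n)) (ha0 : ∀ n, a n (-1) = -1) (ha1 : ∀ n, a n 1 = 1)
    (hb : ∀ n, Monotone (b n)) (hb0 : ∀ n, b n (-1) = -1) (hb1 : ∀ n, b n 1 = 1)
    (hab : ∀ n, ∀ r ∈ Set.Icc (-1 : ℝ) 1, a n r ≤ b n r) :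
    ∃ F : (J × J) ≃ₜ (J × J), (∀ x, (F x).2 = f01 x.2) ∧ (∀ x, (x.2 : ℝ) ≤ 0 → F x = f02 x) ∧
      (∀ x ∈ squareBoundary, F x = f02 x) ∧
      ∀ n, ∀ s : J, (s : ℝ) ∈ V n → ∀ r : J,
        omegaLim F (r, s) = {y | y.2 = jMax ∧ (y.1 : ℝ) ∈ Set.Icc (a n r) (b n r)} := by
  obtain ⟨G, hGc, hGm, hG0, hG1, hGid, hGstep, hGlim⟩ :=
    exists_horizontal_family hV hVsub hVdisj hVend ha ha0 ha1 hb hb0 hb1 hab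
  obtain ⟨F, hF2, hF1⟩ := exists_homeo_of_horizontal_family hGc hGm hG0 hG1 hGid hGstep
  have hF0 : ∀ x, levelTime x.2 ≤ 0 → F x = f02 x := fun x hx => by
    refine Prod.ext (Subtype.ext ?_) (hF2 x)
    rw [hF1 x.1 x.1 x.2 (hGid _ (by linarith) _).symm, hGid _ (by linarith)]
    rfl
  refine ⟨F, hF2, fun x hx => hF0 x (levelTime_nonpos hx), ?_, ?_⟩
  · rintro ⟨r, s⟩ (h | h | h | h) <;> simp only at h <;> subst h
    · refine Prod.ext (Subtype.ext ?_) (hF2 _)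
      rw [hF1 jMin jMin s (hG0 _).symm]
      exact hG0 _
    · refine Prod.ext (Subtype.ext ?_) (hF2 _)
      rw [hF1 jMax jMax s (hG1 _).symm]
      exact hG1 _
    · exact hF0 _ (levelTime_nonpos (by simp [jMin]))
    · exact hF0 _ levelTime_one.le
  · intro n s hs r
    have hs0 := (hVsub n hs).1
    have hs1 := (hVsub n hs).2
    have hτ1 : levelTime s ≤ 1 :=
      (levelTime_strictMonoOn.monotoneOn (Set.mem_Iio.2 (by linarith))
        (Set.mem_Iio.2 (by norm_num)) hs1).trans_eq levelTime_half
    have horbit : ∀ k : ℕ, F^[k] (r, s) = ((F^[k] (r, s)).1, f01^[k] s) ∧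
        ((F^[k] (r, s)).1 : ℝ) = G (levelTime s + k) r ∧
        levelTime (f01^[k] s) = levelTime s + k ∧ 0 ≤ (f01^[k] s : ℝ) ∧ (f01^[k] s : ℝ) < 1 := by
      intro k
      induction k with
      | zero =>
        refine ⟨rfl, ?_, by simp, hs0, by simpa using by linarith⟩
        simpa using (hGid _ hτ1 _).symm
      | succ k ih =>
        obtain ⟨h1, h2, h3, h4, h5⟩ := ih
        have h6 := coe_f01_of_nonneg h4
        simp only [Function.iterate_succ_apply']
        refine ⟨Prod.ext rfl ?_, ?_, ?_, ?_, ?_⟩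
        · rw [hF2, h1]
        · rw [h1, hF1 _ r _ (by rw [h2, h3]), h3]
          push_cast
          rw [add_assoc]
        · rw [h6, levelTime_add_one_div_two h5, h3]
          push_cast
          ring
        · rw [h6]; linarith
        · rw [h6]; linarith
    have hlevel : Tendsto (fun k : ℕ => (F^[k] (r, s)).2) atTop (𝓝 jMax) :=
      (tendsto_f01_iterate hs0).congr fun k => by rw [(horbit k).1]
    have hcoord : ∀ y : ℝ, MapClusterPt y atTop (fun k : ℕ => ((F^[k] (r, s)).1 : ℝ)) ↔
        y ∈ Set.Icc (a n r) (b n r) := fun y => by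
      rw [← hGlim n s hs r r.2 y]
      simp only [fun k => (horbit k).2.1]
    ext y
    constructor
    · rintro hy
      rw [mem_omegaLim_iff] at hy
      refine ⟨?_, (hcoord _).1 ?_⟩
      · obtain ⟨φ, hφ, hlim⟩ := hy.tendsto_subseq
        exact tendsto_nhds_unique ((continuous_snd.tendsto y).comp hlim)
          (hlevel.comp hφ.tendsto_atTop)
      · exact hy.continuousAt_comp (f := fun x : J × J => (x.1 : ℝ)) (by fun_prop)
    · rintro ⟨hy2, hy1⟩
      rw [mem_omegaLim_iff]
      obtain ⟨φ, hφ, hlim⟩ := ((hcoord _).2 hy1).tendsto_subseq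
      refine MapClusterPt.of_comp hφ.tendsto_atTop (Tendsto.mapClusterPt ?_)
      have h1 : Tendsto (fun i => (F^[φ i] (r, s)).1) atTop (𝓝 y.1) :=
        tendsto_subtype_rng.2 hlim
      have h2 := hlevel.comp hφ.tendsto_atTop
      rw [← hy2] at h2
      exact h1.prodMk_nhds h2

/-! ### Families of continua -/

theorem mem_continuum_iff {s : J} {A : Set (J × J)} (hA : A ∈ Continua s) (r : J) :
    (r, s) ∈ A ↔ (r : ℝ) ∈ Set.Icc (sInf (abscissae A)) (sSup (abscissae A)) := by
  have hmin := isLeast_abscissae hA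
  have hmax := isGreatest_abscissae hA
  constructor
  · intro h
    have : (r : ℝ) ∈ abscissae A := ⟨(r, s), h, rfl⟩
    exact ⟨hmin.2 this, hmax.2 this⟩
  · intro h
    have hconn : (abscissae A).OrdConnected :=
      (hA.2.1.isPreconnected.image (fun x : J × J => (x.1 : ℝ)) (by fun_prop)).ordConnected
    obtain ⟨x, hx, hxr⟩ := hconn.out hmin.1 hmax.1 h
    have hx' : x = (r, s) := Prod.ext (Subtype.ext hxr) (hA.1 hx)
    exact hx' ▸ hx

theorem exists_endpoint_functions {s : J} {φ : J → Continua s} (hinc : Increasing φ)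
    (hend : EndpointPreserving φ) :
    ∃ a b : ℝ → ℝ, Monotone a ∧ a (-1) = -1 ∧ a 1 = 1 ∧ Monotone b ∧ b (-1) = -1 ∧ b 1 = 1 ∧
      (∀ r ∈ Set.Icc (-1 : ℝ) 1, a r ≤ b r) ∧
      ∀ r x : J, (x, s) ∈ (φ r : Set (J × J)) ↔ (x : ℝ) ∈ Set.Icc (a r) (b r) := by
  have hle : (-1 : ℝ) ≤ 1 := by norm_num
  have hval0 : ∀ z : J, abscissae {(z, s)} = {(z : ℝ)} := fun z => by simp [abscissae]
  refine ⟨Set.IccExtend hle fun r : J => sInf (abscissae (φ r)),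
    Set.IccExtend hle fun r : J => sSup (abscissae (φ r)), ?_, ?_, ?_, ?_, ?_, ?_, ?_, ?_⟩
  · refine Monotone.IccExtend hle fun r r' h => ?_
    rcases h.eq_or_lt with rfl | h
    exacts [le_rfl, (hinc _ _ h).1]
  · rw [Set.IccExtend_left]
    change sInf (abscissae (φ jMin)) = -1
    rw [hend.1, hval0, csInf_singleton]
    rfl
  · rw [Set.IccExtend_right]
    change sInf (abscissae (φ jMax)) = 1
    rw [hend.2, hval0, csInf_singleton]
    rfl
  · refine Monotone.IccExtend hle fun r r' h => ?_
    rcases h.eq_or_lt with rfl | h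
    exacts [le_rfl, (hinc _ _ h).2]
  · rw [Set.IccExtend_left]
    change sSup (abscissae (φ jMin)) = -1
    rw [hend.1, hval0, csSup_singleton]
    rfl
  · rw [Set.IccExtend_right]
    change sSup (abscissae (φ jMax)) = 1
    rw [hend.2, hval0, csSup_singleton]
    rfl
  · intro r _
    exact (isLeast_abscissae (φ _).2).2 (isGreatest_abscissae (φ _).2).1
  · intro r x
    rw [Set.IccExtend_val, Set.IccExtend_val]
    exact mem_continuum_iff (φ r).2 x

/-- The continua may be given on either horizontal edge `J × {e}`; they are realized on the top
edge. The bottom edge serves for the `α`-limit sets, which are mirror images of `ω`-limit sets. -/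
theorem exists_homeo_omegaLim_continua {N : Set ℕ} {V : N → Set ℝ}
    (hV : ∀ n, (V n).OrdConnected) (hVsub : ∀ n, V n ⊆ Set.Icc 0 (1 / 2))
    (hVdisj : Pairwise fun m n => Disjoint (V m) (V n))
    (hVend : ∀ m n, (0 : ℝ) ∈ V m → (1 / 2 : ℝ) ∉ V n) {e : J} {φ : N → J → Continua e}
    (hinc : ∀ n, Increasing (φ n)) (hend : ∀ n, EndpointPreserving (φ n)) :
    ∃ F : (J × J) ≃ₜ (J × J), (∀ x, (F x).2 = f01 x.2) ∧ (∀ x, (x.2 : ℝ) ≤ 0 → F x = f02 x) ∧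
      (∀ x ∈ squareBoundary, F x = f02 x) ∧
      ∀ n, ∀ s : J, (s : ℝ) ∈ V n → ∀ r : J,
        omegaLim F (r, s) = {y | y.2 = jMax ∧ (y.1, e) ∈ (φ n r : Set (J × J))} := by
  classical
  choose a b ha ha0 ha1 hb hb0 hb1 hab hφ using fun n =>
    exists_endpoint_functions (hinc n) (hend n)
  -- indices outside `N` get the empty set of levels and the identity as endpoint functions
  let V' : ℕ → Set ℝ := fun n => if h : n ∈ N then V ⟨n, h⟩ else ∅
  let a' : ℕ → ℝ → ℝ := fun n => if h : n ∈ N then a ⟨n, h⟩ else id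
  let b' : ℕ → ℝ → ℝ := fun n => if h : n ∈ N then b ⟨n, h⟩ else id
  have hV' : ∀ n x, x ∈ V' n ↔ ∃ h : n ∈ N, x ∈ V ⟨n, h⟩ := fun n x => by
    by_cases h : n ∈ N <;> simp [V', h]
  obtain ⟨F, h2, h0, hbd, hlim⟩ := exists_homeo_omegaLim (V := V') (a := a') (b := b')
    (fun n => by
      by_cases h : n ∈ N
      · simpa [V', h] using hV ⟨n, h⟩
      · simpa [V', h] using Set.ordConnected_empty)
    (fun n x hx => by
      obtain ⟨h, hx⟩ := (hV' n x).1 hx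
      exact hVsub _ hx)
    (fun m n hmn => Set.disjoint_left.2 fun x hm hn => by
      obtain ⟨h, hm⟩ := (hV' m x).1 hm
      obtain ⟨h', hn⟩ := (hV' n x).1 hn
      exact Set.disjoint_left.1 (hVdisj fun heq => hmn (congrArg Subtype.val heq)) hm hn)
    (fun m n hm hn => by
      obtain ⟨h, hm⟩ := (hV' m _).1 hm
      obtain ⟨h', hn⟩ := (hV' n _).1 hn
      exact hVend _ _ hm hn)
    (fun n => by simp only [a']; split_ifs; exacts [ha _, monotone_id])
    (fun n => by simp only [a']; split_ifs; exacts [ha0 _, rfl])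
    (fun n => by simp only [a']; split_ifs; exacts [ha1 _, rfl])
    (fun n => by simp only [b']; split_ifs; exacts [hb _, monotone_id])
    (fun n => by simp only [b']; split_ifs; exacts [hb0 _, rfl])
    (fun n => by simp only [b']; split_ifs; exacts [hb1 _, rfl])
    (fun n r hr => by simp only [a', b']; split_ifs; exacts [hab _ r hr, le_rfl])
  refine ⟨F, h2, h0, hbd, fun n s hs r => ?_⟩
  rw [hlim n s ((hV' _ _).2 ⟨n.2, hs⟩) r]
  ext y
  change _ ∧ _ ↔ _ ∧ _
  rw [hφ n r y.1]
  simp [a', b']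

/-! ### Both limit sets at once -/

/-- The reflection `(r, s) ↦ (r, -s)` of the square. -/
def reflect : (J × J) ≃ₜ (J × J) := (Homeomorph.refl J).prodCongr jNeg

@[simp] theorem reflect_apply (x : J × J) : reflect x = (x.1, jNeg x.2) := rfl

@[simp] theorem reflect_reflect (x : J × J) : reflect (reflect x) = x := by simp

@[simp] theorem reflect_symm : reflect.symm = reflect := rfl

theorem reflect_mem_squareBoundary {x : J × J} (hx : x ∈ squareBoundary) :
    reflect x ∈ squareBoundary := by
  obtain ⟨r, s⟩ := x
  rcases hx with h | h | h | h <;> simp only at h <;> subst h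
  · exact Or.inl rfl
  · exact Or.inr (Or.inl rfl)
  · exact Or.inr (Or.inr (Or.inr (Subtype.ext (by simp [jMin, jMax]))))
  · exact Or.inr (Or.inr (Or.inl (Subtype.ext (by simp [jMin, jMax]))))

theorem f02_reflect_f02 (x : J × J) : f02 (reflect (f02 x)) = reflect x :=
  Prod.ext rfl (f01_jNeg_f01 x.2)

/-- A rising homeomorphism may be prescribed by `P` above and by the mirror image of `Q⁻¹` below:
the homeomorphism `P ∘ f₀₂⁻¹ ∘ (mirror image of Q⁻¹)` has this property since the two factors
differ from `f₀₂` on disjoint strips only. -/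
theorem exists_normallyRising_of_halves {P Q : (J × J) ≃ₜ (J × J)}
    (hP2 : ∀ x, (P x).2 = f01 x.2) (hP0 : ∀ x, (x.2 : ℝ) ≤ 0 → P x = f02 x)
    (hPbd : ∀ x ∈ squareBoundary, P x = f02 x)
    (hQ2 : ∀ x, (Q x).2 = f01 x.2) (hQ0 : ∀ x, (x.2 : ℝ) ≤ 0 → Q x = f02 x)
    (hQbd : ∀ x ∈ squareBoundary, Q x = f02 x) :
    ∃ f : (J × J) ≃ₜ (J × J), NormallyRising f ∧ (∀ x, 0 ≤ (x.2 : ℝ) → f x = P x) ∧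
      ∀ x, (x.2 : ℝ) ≤ 1 / 2 → f.symm x = reflect (Q (reflect x)) := by
  let R : (J × J) ≃ₜ (J × J) := reflect.trans (Q.symm.trans reflect)
  have hR : ∀ x, R x = reflect (Q.symm (reflect x)) := fun x => rfl
  have hRf02 : ∀ x, Q (reflect (f02 x)) = f02 (reflect (f02 x)) → R x = f02 x := fun x hx => by
    rw [hR, ← f02_reflect_f02 x, ← hx, Homeomorph.symm_apply_apply, reflect_reflect]
  have hR2 : ∀ x, (R x).2 = f01 x.2 := fun x => by
    refine f01Homeo.injective.comp jNeg.injective ?_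
    change f01 (jNeg (R x).2) = f01 (jNeg (f01 x.2))
    rw [f01_jNeg_f01, hR, reflect_apply, jNeg_jNeg, ← hQ2, Homeomorph.apply_symm_apply,
      reflect_apply]
  let f : (J × J) ≃ₜ (J × J) := R.trans (f02Homeo.symm.trans P)
  have hf : ∀ x, f x = P (f02Homeo.symm (R x)) := fun x => rfl
  have hfP : ∀ x, R x = f02 x → f x = P x := fun x hx => by
    rw [hf, hx, ← f02Homeo_apply, Homeomorph.symm_apply_apply]
  have hfR : ∀ x, (x.2 : ℝ) ≤ 0 → f x = R x := fun x hx => by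
    have h : (f02Homeo.symm (R x)).2 = x.2 := by
      change f01Homeo.symm (R x).2 = x.2
      rw [hR2]
      exact f01Homeo.symm_apply_apply x.2
    rw [hf, hP0 _ (by rw [h]; exact hx), ← f02Homeo_apply, Homeomorph.apply_symm_apply]
  have hf2 : ∀ x, (f x).2 = f01 x.2 := fun x => by
    rw [hf, hP2, ← hR2 x]
    exact f01Homeo.apply_symm_apply (R x).2
  refine ⟨f, ⟨fun x hx => ?_, fun s => ?_⟩, fun x hx => hfP x (hRf02 x (hQ0 _ ?_)), fun x hx => ?_⟩
  · rw [hfP x (hRf02 x (hQbd _ (reflect_mem_squareBoundary (f02_mem_squareBoundary hx)))),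
      hPbd x hx]
  · have himage : ∀ g : (J × J) ≃ₜ (J × J), (∀ x, (g x).2 = f01 x.2) →
        g '' level s = level (f01 s) := fun g hg => by
      ext y
      obtain ⟨x, rfl⟩ := g.surjective y
      rw [g.injective.mem_set_image]
      change x.2 = s ↔ (g x).2 = f01 s
      rw [hg]
      exact f01Homeo.injective.eq_iff.symm
    rw [himage f hf2]
    exact (himage f02Homeo fun x => rfl).symm
  · change -(f01 x.2 : ℝ) ≤ 0
    rw [coe_f01_of_nonneg hx]
    linarith
  · have h : ((reflect (Q (reflect x))).2 : ℝ) ≤ 0 := by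
      rw [reflect_apply, coe_jNeg, hQ2]
      exact neg_nonpos.2 (f01_jNeg_nonneg hx)
    rw [Homeomorph.symm_apply_eq, hfR _ h, hR, reflect_reflect, Homeomorph.symm_apply_apply,
      reflect_reflect]

end LimitSets


open LimitSets
theorem theorem1p1 (N' N'' : Set ℕ) (hN' : N'.Nonempty) (hN'' : N''.Nonempty)
    (V : N' → Set ℝ) (W : N'' → Set ℝ)
    (hVsub : ∀ n, V n ⊆ Set.Ioc (0 : ℝ) (1 / 2))
    (hWsub : ∀ j, W j ⊆ Set.Ioc (0 : ℝ) (1 / 2))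
    (hVconn : ∀ n, IsConnected (V n))
    (hWconn : ∀ j, IsConnected (W j))
    (hVdisj : Pairwise fun m n => Disjoint (V m) (V n))
    (hWdisj : Pairwise fun i j => Disjoint (W i) (W j))
    (ω : N' → J → TopContinua) (α : N'' → J → BottomContinua)
    (hωinc : ∀ n, Increasing (ω n)) (hωend : ∀ n, EndpointPreserving (ω n))
    (hαinc : ∀ j, Increasing (α j)) (hαend : ∀ j, EndpointPreserving (α j)) :
    ∃ f : (J × J) ≃ₜ (J × J), NormallyRising f ∧
      (∀ n, ∀ s : J, (s : ℝ) ∈ V n → omegaSlice f s = fun r => (ω n r : Set (J × J))) ∧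
      (∀ j, ∀ t : J, (t : ℝ) ∈ W j → alphaSlice f t = fun r => (α j r : Set (J × J))) := by
  obtain ⟨P, hP2, hP0, hPbd, hPlim⟩ := exists_homeo_omegaLim_continua (V := V)
    (fun n => (hVconn n).isPreconnected.ordConnected)
    (fun n => (hVsub n).trans Set.Ioc_subset_Icc_self) hVdisj
    (fun m n h0 _ => lt_irrefl _ (hVsub m h0).1) hωinc hωend
  -- `f⁻¹` carries the level `t ∈ (0, 1 / 2]` to `t - 1 / 2`, the mirror image of `1 / 2 - t`
  obtain ⟨Q, hQ2, hQ0, hQbd, hQlim⟩ := exists_homeo_omegaLim_continua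
    (V := fun j => (fun x : ℝ => 1 / 2 - x) ⁻¹' W j)
    (fun j => (hWconn j).isPreconnected.ordConnected.preimage_anti
      fun x y h => sub_le_sub_left h _)
    (fun j x hx => ⟨by linarith [(hWsub j hx).2], by linarith [(hWsub j hx).1]⟩)
    (fun i j hij => (hWdisj hij).preimage _)
    (fun i j _ h => by simpa using (hWsub j h).1) hαinc hαend
  obtain ⟨f, hf, hfP, hfQ⟩ := exists_normallyRising_of_halves hP2 hP0 hPbd hQ2 hQ0 hQbd
  refine ⟨f, hf, fun n s hs => funext fun r => ?_, fun j t ht => funext fun r => ?_⟩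
  · have h1 : omegaLim f (r, s) = omegaLim P (r, s) := by
      refine omegaLim_congr (S := {x : J × J | 0 ≤ (x.2 : ℝ)}) (fun x hx => hfP x hx)
        (fun x (hx : 0 ≤ (x.2 : ℝ)) => ?_) (hVsub n hs).1.le
      change 0 ≤ ((P x).2 : ℝ)
      rw [hP2, coe_f01_of_nonneg hx]
      linarith
    rw [omegaSlice, h1, hPlim n s hs r]
    ext ⟨y₁, y₂⟩
    constructor
    · rintro ⟨rfl, h⟩
      exact h
    · intro h
      obtain rfl : y₂ = jMax := (ω n r).2.1 h
      exact ⟨rfl, h⟩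
  · have h1 : omegaLim f.symm (r, t) = omegaLim (reflect ∘ Q ∘ reflect.symm) (r, t) := by
      refine omegaLim_congr (S := {x : J × J | (x.2 : ℝ) ≤ 1 / 2}) (fun x hx => hfQ x hx)
        (fun x (hx : (x.2 : ℝ) ≤ 1 / 2) => ?_) (hWsub j ht).2
      change -((Q (reflect x)).2 : ℝ) ≤ 1 / 2
      rw [hQ2]
      have h := f01_jNeg_nonneg hx
      exact (neg_nonpos.2 h).trans (by norm_num)
    have ht0 := (hWsub j ht).1
    have ht1 := (hWsub j ht).2
    have hlevel : (f01 (jNeg t) : ℝ) = 1 / 2 - t := by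
      rw [coe_f01, coe_jNeg, if_neg (by linarith), if_pos (by linarith)]
      ring
    have h2 : Q (r, jNeg t) = (r, f01 (jNeg t)) := hQ0 _ (by simpa using ht0.le)
    have h3 : (f01 (jNeg t) : ℝ) ∈ (fun x : ℝ => 1 / 2 - x) ⁻¹' W j := by
      rw [hlevel]
      simpa using ht
    rw [alphaSlice, alphaLim, h1, omegaLim_conj, reflect_symm, reflect_apply,
      ← omegaLim_apply, h2, hQlim j _ h3 r]
    ext ⟨y₁, y₂⟩
    rw [Homeomorph.image_eq_preimage_symm, reflect_symm, Set.mem_preimage, reflect_apply]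
    constructor
    · rintro ⟨h, h'⟩
      have hy : y₂ = jMin := by
        rw [← jNeg_jNeg y₂]
        exact (congrArg jNeg h).trans (Subtype.ext (by simp [jMin, jMax]))
      exact hy ▸ h'
    · intro h
      obtain rfl : y₂ = jMin := (α j r).2.1 h
      exact ⟨Subtype.ext (by simp [jMin, jMax]), h⟩
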